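/- A positive sequence $M=(M_k)_{k\ge 0}$ is a \emph{weight sequence} if $M_k=\mu_0\mu_1\cdots\mu_k$ with $1=\mu_0\le\mu_1\le\mu_2\le\cdots$ and $\mu_k\to\infty$; it is \emph{non-quasianalytic} if $\sum_{k\ge1}1/\mu_k<\infty$. A \emph{weight matrix} is a family $\mathfrak M=\{M^{(x)}:x>0\}$ of weight sequences with $M^{(x)}\le M^{(y)}$ for $x\le y$; it is non-quasianalytic if all $M\in\mathfrak M$ are, and it has \emph{R-moderate growth} if for every $M\in\mathfrak M$ there are $N\in\mathfrak M$ and $C\ge1$ with $M_{j+k}\le C^{j+k}N_jN_k$ for all $j,k\in\mathbb N$. For positive sequences $M,N$ write $M\preceq N$ if $\sup_{k\ge1}(M_k/N_k)^{1/k}<\infty$, and put $M^{[n]}_j:=(M_{nj})^{1/n}$ for $n\in\mathbb N_{\ge1}$. For a positive sequence $M'$ and a non-quasianalytic weight sequence $M$ write $M'\prec_{SV}M$ if there is $s\in\mathbb N_{\ge1}$ with $$\sup_{j\ge1}\ \frac{\sup_{0\le i<j}\bigl(\frac{M'_j}{s^jM_i}\bigr)^{1/(j-i)}}{j}\sum_{k\ge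 j}\frac1{\mu_k}<\infty .$$ For a family $\mathfrak M$ of positive sequences let $\Lambda^{\{\mathfrak M\}}$ be the set of all $a\in\mathbb C^{\mathbb N}$ for which there are $M\in\mathfrak M$ and $\sigma\in\mathbb N_{\ge1}$ with $\sup_k |a_k|/(\sigma^kM_k)<\infty$; let $\mathcal E^{\{\mathfrak M\}}(\mathbb R)$ be the set of all $f\in C^\infty(\mathbb R,\mathbb C)$ such that for every $n\in\mathbb N$ there are $M\in\mathfrak M$ and $\sigma\in\mathbb N_{\ge1}$ with $\sup_{x\in[-n,n],\,k\in\mathbb N}|f^{(k)}(x)|/(\sigma^kM_k)<\infty$; and let $j^\infty f:=(f^{(k)}(0))_{k\in\mathbb N}$. \textbf{Proposition.} Let $\mathfrak M$ be a non-quasianalytic weight matrix of R-moderate growth, and let $\mathfrak M'$ be a family of positive sequences (with an arbitrary index set, for instance a one-parameter family) such that $\liminf_{k\to\infty}(M'_k/k!)^{1/k}>0$ for all $M'\in\mathfrak M'$. Let $\widehat M'\in\mathfrak M'$ be such that for every $M'\in\mathfrak M'$ there is $n\in\mathbb N_{\ge1}$ with $M'\preceq(\widehat M')^{[n]}$. If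 there is $\widehat M\in\mathfrak M$ with $\widehat M'\prec_{SV}\widehat M$, then $\Lambda^{\{\mathfrak M'\}}\subseteq j^\infty\mathcal E^{\{\mathfrak M\}}(\mathbb R)$. -/

import Mathlib

open Set Filter Topology
open scoped Nat ContDiff

noncomputable section

namespace MixedBorel

/-- The sequence `μ` of successive quotients of `M`: `μ_0 = M_0` and `μ_k = M_k / M_{k-1}`
for `k ≥ 1`, so that `M_k = μ_0 μ_1 ⋯ μ_k` for a positive sequence `M`. -/
def quot (M : ℕ → ℝ) : ℕ → ℝ
  | 0 => M 0
  | k + 1 => M (k + 1) / M k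

/-- A positive sequence. -/
def IsPositive (M : ℕ → ℝ) : Prop := ∀ k, 0 < M k

/-- A weight sequence: a positive sequence `M_k = μ_0 μ_1 ⋯ μ_k` with
`1 = μ_0 ≤ μ_1 ≤ ⋯` and `μ_k → ∞`. -/
structure IsWeightSequence (M : ℕ → ℝ) : Prop where
  pos : IsPositive M
  quot_zero : quot M 0 = 1
  quot_mono : Monotone (quot M)
  quot_tendsto : Tendsto (quot M) atTop atTop

/-- Non-quasianalyticity: `∑_{k ≥ 1} 1 / μ_k < ∞`. -/
def IsNonQuasianalytic (M : ℕ → ℝ) : Prop :=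
  Summable fun k : ℕ => 1 / quot M (k + 1)

/-- The relation `M ⪯ N`: `sup_{k ≥ 1} (M_k / N_k)^{1/k} < ∞`. -/
def Preceq (M N : ℕ → ℝ) : Prop :=
  ∃ C : ℝ, ∀ k : ℕ, 1 ≤ k → (M k / N k) ^ (1 / (k : ℝ)) ≤ C

/-- The sequence `M^{[n]}`, `M^{[n]}_j = (M_{nj})^{1/n}`, for `n ≥ 1`. -/
def bracket (M : ℕ → ℝ) (n : ℕ) : ℕ → ℝ :=
  fun j => M (n * j) ^ (1 / (n : ℝ))

/-- The condition `liminf_{k → ∞} (M_k / k!)^{1/k} > 0` for a positive sequence `M`.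
The limes inferior is taken in `[0, ∞]`, since it may be infinite. -/
def LiminfPos (M : ℕ → ℝ) : Prop :=
  0 < liminf (fun k : ℕ => ENNReal.ofReal ((M k / (k ! : ℝ)) ^ (1 / (k : ℝ)))) atTop

/-- The relation `M' ≺_SV M` between a positive sequence `M'` and a non-quasianalytic weight
sequence `M`:
there is an integer `s ≥ 1` such that
`sup_{j ≥ 1} (1/j) (sup_{0 ≤ i < j} (M'_j / (s^j M_i))^{1/(j-i)}) ∑_{k ≥ j} 1/μ_k < ∞`. -/
def PrecSV (M' M : ℕ → ℝ) : Prop :=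
  ∃ s : ℕ, 1 ≤ s ∧ ∃ B : ℝ, ∀ j : ℕ, 1 ≤ j →
    (⨆ i : Fin j, (M' j / ((s : ℝ) ^ j * M i)) ^ (1 / ((j : ℝ) - ((i : ℕ) : ℝ)))) / (j : ℝ)
      * (∑' k : ℕ, 1 / quot M (j + k)) ≤ B

/-- A weight matrix: a family of weight sequences `M^{(x)}`, `x > 0`, with
`M^{(x)} ≤ M^{(y)}` for `x ≤ y`. -/
structure IsWeightMatrix (M : Ioi (0 : ℝ) → ℕ → ℝ) : Prop where
  isWeightSequence : ∀ x, IsWeightSequence (M x)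
  mono : ∀ x y, x ≤ y → ∀ k, M x k ≤ M y k

/-- R-moderate growth of a family of sequences. -/
def HasRModerateGrowth {ι : Type*} (M : ι → ℕ → ℝ) : Prop :=
  ∀ x, ∃ y, ∃ C : ℝ, 1 ≤ C ∧ ∀ j k : ℕ, M x (j + k) ≤ C ^ (j + k) * M y j * M y k

/-- The (global) smooth functions `f : ℝ → ℂ` whose restriction to `[-n, n]` belongs to
`ℰ^M_σ([-n, n])`: `sup_{x ∈ [-n,n], k ∈ ℕ} |f^{(k)}(x)| / (σ^k M_k) < ∞`. -/
def functionSpaceOn (M : ℕ → ℝ) (σ : ℝ) (n : ℕ) : Set (ℝ → ℂ) :=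
  {f | ContDiff ℝ ∞ f ∧ ∃ C : ℝ, ∀ x ∈ Icc (-(n : ℝ)) (n : ℝ), ∀ k : ℕ,
    ‖iteratedDeriv k f x‖ / (σ ^ k * M k) ≤ C}

/-- The underlying set of the Roumieu class `ℰ^{𝔐}(ℝ)`: the projective limit over `n` of the
inductive limits over the members of `𝔐` and the integers `σ ≥ 1`. -/
def functionClass {ι : Type*} (M : ι → ℕ → ℝ) : Set (ℝ → ℂ) :=
  ⋂ n : ℕ, ⋃ x : ι, ⋃ σ ∈ {σ : ℕ | 1 ≤ σ}, functionSpaceOn (M x) (σ : ℝ) n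

/-- The sequence space `Λ^M_σ`: `sup_k |a_k| / (σ^k M_k) < ∞`. -/
def sequenceSpace (M : ℕ → ℝ) (σ : ℝ) : Set (ℕ → ℂ) :=
  {a | ∃ C : ℝ, ∀ k : ℕ, ‖a k‖ / (σ ^ k * M k) ≤ C}

/-- The underlying set of the sequence space `Λ^{𝔐}`: the union of all `Λ^M_σ` over the
members `M` of `𝔐` and the integers `σ ≥ 1`. -/
def sequenceClass {ι : Type*} (M : ι → ℕ → ℝ) : Set (ℕ → ℂ) :=
  ⋃ x : ι, ⋃ σ ∈ {σ : ℕ | 1 ≤ σ}, sequenceSpace (M x) (σ : ℝ)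

/-- The Borel map `j^∞ f = (f^{(k)}(0))_k`. -/
def borelMap (f : ℝ → ℂ) : ℕ → ℂ := fun k => iteratedDeriv k f 0

end MixedBorel

end

/-! It suffices to find smooth functions `ψ p` dual to the derivatives at 0, with `|ψ_p^{(k)}| W_p ≤
A D^p (2C)^k N_k`, where `W = bracket M' n` and `N` belongs to the matrix. The series `∑ t^{-p} a_p
ψ_p(t x)` then has the prescribed jet: a large dilation `t` absorbs the geometric loss in `p` and
costs only `t^k`.

The functions are `x^p/p!` times a cutoff. An infinite iterated average with summable half-widths
`1/θ_i` gives a cutoff with k-th derivative at most `θ_0 ⋯ θ_{k-1}`. Here `θ` is the quotient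
sequence of `M` with its first `np` entries flattened to a slope `β`; `≺_SV` at index `np` supplies
`β` (`PrecSV.exists_slope`). It makes the support so short that the monomial costs only `exp(O(np))`
(`exists_dual_function`), and it compares `M'_{np}` with `M_{nk}` (`prod_flatQuot_pow_mul_le`).
Iterated moderate growth bounds `M_{nk}` by `C^k N_k^n`, and an n-th root gives the claim. -/

namespace MixedBorel

/-! ### Averages and symmetric difference quotients -/

/-- The average of `u` over `[x - a, x + a]`. -/
noncomputable def avg (a : ℝ) (u : ℝ → ℝ) (x : ℝ) : ℝ :=
  (2 * a)⁻¹ * ∫ y in (x - a)..(x + a), u y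

/-- The symmetric difference quotient with step `a`. -/
noncomputable def symmQuot (a : ℝ) (u : ℝ → ℝ) (x : ℝ) : ℝ :=
  (2 * a)⁻¹ * (u (x + a) - u (x - a))

theorem abs_avg_sub_le {a : ℝ} (ha : 0 < a) {u : ℝ → ℝ} (hu : Continuous u) {x c ε : ℝ}
    (h : ∀ y, |y - x| ≤ a → |u y - c| ≤ ε) : |avg a u x - c| ≤ ε := by
  have h1 : avg a u x - c = (2 * a)⁻¹ * ∫ y in (x - a)..(x + a), (u y - c) := by
    rw [intervalIntegral.integral_sub (hu.intervalIntegrable _ _) (by simp)]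
    simp only [avg, intervalIntegral.integral_const, smul_eq_mul]
    field_simp
    ring
  have h2 : ‖∫ y in (x - a)..(x + a), (u y - c)‖ ≤ ε * |(x + a) - (x - a)| := by
    apply intervalIntegral.norm_integral_le_of_norm_le_const
    intro y hy
    rw [uIoc_of_le (by linarith)] at hy
    exact h y (abs_le.2 ⟨by linarith [hy.1], by linarith [hy.2]⟩)
  rw [h1, abs_mul, abs_of_pos (by positivity : 0 < (2 * a)⁻¹)]
  rw [show (x + a) - (x - a) = 2 * a by ring, abs_of_pos (by positivity : 0 < 2 * a)] at h2
  calc (2 * a)⁻¹ * |∫ y in (x - a)..(x + a), (u y - c)| ≤ (2 * a)⁻¹ * (ε * (2 * a)) := by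
        gcongr; exact h2
    _ = ε := by field_simp

theorem hasDerivAt_avg {a : ℝ} {u : ℝ → ℝ} (hu : Continuous u) (x : ℝ) :
    HasDerivAt (avg a u) (symmQuot a u x) x := by
  have h (y : ℝ) : avg a u y
      = (2 * a)⁻¹ * ((∫ t in (0 : ℝ)..(y + a), u t) - ∫ t in (0 : ℝ)..(y - a), u t) := by
    rw [intervalIntegral.integral_interval_sub_left (hu.intervalIntegrable _ _)
      (hu.intervalIntegrable _ _)]
    rfl
  have hF (z : ℝ) : HasDerivAt (fun z => ∫ t in (0 : ℝ)..z, u t) (u z) z :=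
    intervalIntegral.integral_hasDerivAt_right (hu.intervalIntegrable _ _)
      hu.aestronglyMeasurable.stronglyMeasurableAtFilter hu.continuousAt
  rw [show avg a u = _ from funext h]
  exact (((hF (x + a)).comp_add_const x a).sub ((hF (x - a)).comp_sub_const x a)).const_mul _

theorem continuous_avg {a : ℝ} {u : ℝ → ℝ} (hu : Continuous u) : Continuous (avg a u) :=
  continuous_iff_continuousAt.2 fun x => (hasDerivAt_avg hu x).continuousAt

theorem hasDerivAt_avg_of_hasDerivAt {a : ℝ} {u g : ℝ → ℝ} (hg : Continuous g)
    (h : ∀ x, HasDerivAt u (g x) x) (x : ℝ) : HasDerivAt (avg a u) (avg a g x) x := by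
  have hu : Continuous u := continuous_iff_continuousAt.2 fun x => (h x).continuousAt
  have h1 := hasDerivAt_avg (a := a) hu x
  have h2 : symmQuot a u x = avg a g x := by
    rw [symmQuot, avg, intervalIntegral.integral_eq_sub_of_hasDerivAt (fun y _ => h y)
      (hg.intervalIntegrable _ _)]
  rwa [h2] at h1

theorem lipschitzWith_avg {a : ℝ} (ha : 0 < a) {u : ℝ → ℝ} {K : NNReal} (hu : LipschitzWith K u) :
    LipschitzWith K (avg a u) := by
  refine LipschitzWith.of_dist_le_mul fun x z => ?_
  have hc := hu.continuous
  have hc' : Continuous fun y => u (y + (z - x)) := hc.comp (by fun_prop)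
  have h1 : avg a (fun y => u (y + (z - x))) x = avg a u z := by
    simp only [avg]
    rw [intervalIntegral.integral_comp_add_right]
    congr 2 <;> ring
  -- Averaging commutes with translation, so the difference of two averages is the average of a
  -- difference of translates.
  have h2 : avg a u x - avg a u z = avg a (fun y => u y - u (y + (z - x))) x := by
    rw [← h1]
    simp only [avg]
    rw [intervalIntegral.integral_sub (hc.intervalIntegrable _ _)
      (hc'.intervalIntegrable _ _)]
    ring
  rw [Real.dist_eq, h2, ← sub_zero (avg a _ x)]
  refine abs_avg_sub_le ha (hc.sub hc') fun y _ => ?_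
  have := hu.dist_le_mul y (y + (z - x))
  rw [Real.dist_eq, Real.dist_eq] at this
  rwa [sub_zero, Real.dist_eq, show x - z = y - (y + (z - x)) by ring]

theorem lipschitzWith_symmQuot {a : ℝ} {u : ℝ → ℝ} {K : NNReal}
    (hu : LipschitzWith K u) : ∃ K', LipschitzWith K' (symmQuot a u) := by
  refine ⟨‖(2 * a)⁻¹‖₊ * (K + K), LipschitzWith.of_dist_le_mul fun x z => ?_⟩
  have h1 := hu.dist_le_mul (x + a) (z + a)
  have h2 := hu.dist_le_mul (x - a) (z - a)
  simp only [Real.dist_eq, add_sub_add_right_eq_sub, sub_sub_sub_cancel_right] at h1 h2 ⊢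
  rw [symmQuot, symmQuot, ← mul_sub, abs_mul]
  push_cast
  rw [mul_assoc, Real.norm_eq_abs]
  gcongr
  calc |u (x + a) - u (x - a) - (u (z + a) - u (z - a))|
      = |(u (x + a) - u (z + a)) - (u (x - a) - u (z - a))| := by congr 1; ring
    _ ≤ _ := abs_sub _ _
    _ ≤ (K + K) * |x - z| := by linarith

theorem abs_symmQuot_le {a : ℝ} (ha : 0 < a) {u : ℝ → ℝ} {c : ℝ} (hu : ∀ x, |u x| ≤ c) (x : ℝ) :
    |symmQuot a u x| ≤ c * (1 / a) := by
  rw [symmQuot, abs_mul, abs_of_pos (by positivity : 0 < (2 * a)⁻¹)]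
  calc (2 * a)⁻¹ * |u (x + a) - u (x - a)| ≤ (2 * a)⁻¹ * (c + c) := by
        gcongr
        exact (abs_sub _ _).trans (add_le_add (hu _) (hu _))
    _ = c * (1 / a) := by field_simp; ring

/-! ### Infinite iterated averages -/

/-- Successive averages of `u` with half-widths `a 0, …, a (m - 1)`. -/
noncomputable def iterAvg (a : ℕ → ℝ) (u : ℝ → ℝ) : ℕ → ℝ → ℝ
  | 0 => u
  | m + 1 => avg (a m) (iterAvg a u m)

/-- Isolates the innermost average, the one that will be differentiated into a difference quotient.
-/
theorem iterAvg_succ' (a : ℕ → ℝ) (u : ℝ → ℝ) (m : ℕ) :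
    iterAvg a u (m + 1) = iterAvg (fun i => a (i + 1)) (avg (a 0) u) m := by
  induction m with
  | zero => rfl
  | succ m ih => rw [iterAvg, ih]; rfl

theorem continuous_iterAvg (a : ℕ → ℝ) {u : ℝ → ℝ} (hu : Continuous u) (m : ℕ) :
    Continuous (iterAvg a u m) := by
  induction m with
  | zero => exact hu
  | succ m ih => exact continuous_avg ih

theorem lipschitzWith_iterAvg {a : ℕ → ℝ} (ha : ∀ i, 0 < a i) {u : ℝ → ℝ} {K : NNReal}
    (hu : LipschitzWith K u) (m : ℕ) : LipschitzWith K (iterAvg a u m) := by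
  induction m with
  | zero => exact hu
  | succ m ih => exact lipschitzWith_avg (ha m) ih

theorem hasDerivAt_iterAvg (a : ℕ → ℝ) {u g : ℝ → ℝ} (hg : Continuous g)
    (h : ∀ x, HasDerivAt u (g x) x) (m : ℕ) (x : ℝ) :
    HasDerivAt (iterAvg a u m) (iterAvg a g m x) x := by
  induction m generalizing x with
  | zero => exact h x
  | succ m ih => exact hasDerivAt_avg_of_hasDerivAt (continuous_iterAvg a hg m) ih x

theorem abs_iterAvg_sub_le {a : ℕ → ℝ} (ha : ∀ i, 0 < a i) {u : ℝ → ℝ} (hu : Continuous u)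
    {c ε : ℝ} (m : ℕ) (x : ℝ) (h : ∀ y, |y - x| ≤ ∑ i ∈ Finset.range m, a i → |u y - c| ≤ ε) :
    |iterAvg a u m x - c| ≤ ε := by
  induction m generalizing x with
  | zero => exact h x (by simp)
  | succ m ih =>
    refine abs_avg_sub_le (ha m) (continuous_iterAvg a hu m) fun y hy => ih y fun z hz => h z ?_
    rw [Finset.sum_range_succ]
    calc |z - x| = |(z - y) + (y - x)| := by ring_nf
      _ ≤ |z - y| + |y - x| := abs_add_le _ _
      _ ≤ _ := add_le_add hz hy

/-- The limit of the successive averages of `u` with half-widths `a 0, a 1, …`. -/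
noncomputable def smoothing (a : ℕ → ℝ) (u : ℝ → ℝ) (x : ℝ) : ℝ :=
  limUnder atTop fun m => iterAvg a u m x

section

variable {a : ℕ → ℝ} {u : ℝ → ℝ} {K : NNReal}

theorem dist_iterAvg_succ_le (ha : ∀ i, 0 < a i) (hu : LipschitzWith K u) (x : ℝ) (m : ℕ) :
    dist (iterAvg a u m x) (iterAvg a u (m + 1) x) ≤ K * a m := by
  rw [dist_comm, Real.dist_eq]
  have hL := lipschitzWith_iterAvg ha hu m
  refine abs_avg_sub_le (ha m) hL.continuous fun y hy => ?_
  have := hL.dist_le_mul y x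
  rw [Real.dist_eq, Real.dist_eq] at this
  exact this.trans (by gcongr)

theorem tendsto_iterAvg (ha : ∀ i, 0 < a i) (hs : Summable a) (hu : LipschitzWith K u) (x : ℝ) :
    Tendsto (fun m => iterAvg a u m x) atTop (𝓝 (smoothing a u x)) :=
  tendsto_nhds_limUnder (cauchySeq_tendsto_of_complete
    (cauchySeq_of_dist_le_of_summable _ (dist_iterAvg_succ_le ha hu x) (hs.mul_left _)))

theorem tendstoUniformly_iterAvg (ha : ∀ i, 0 < a i) (hs : Summable a) (hu : LipschitzWith K u) :
    TendstoUniformly (iterAvg a u) (smoothing a u) atTop := by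
  have h0 := tendsto_sum_nat_add fun m => K * a m
  rw [Metric.tendstoUniformly_iff]
  intro ε hε
  filter_upwards [h0.eventually_lt_const hε] with m hm x
  rw [dist_comm]
  refine lt_of_le_of_lt (dist_le_tsum_of_dist_le_of_tendsto _ (dist_iterAvg_succ_le ha hu x)
    (hs.mul_left _) (tendsto_iterAvg ha hs hu x) m) ?_
  simpa only [add_comm] using hm

/-- The derivative falls on the innermost average and the outer ones commute with it. The result is
again a smoothing of a Lipschitz function, with shifted widths, so the statement can be iterated. -/
theorem hasDerivAt_smoothing (ha : ∀ i, 0 < a i) (hs : Summable a) (hu : LipschitzWith K u)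
    (x : ℝ) :
    HasDerivAt (smoothing a u) (smoothing (fun i => a (i + 1)) (symmQuot (a 0) u) x) x := by
  have hs' : Summable fun i => a (i + 1) := (summable_nat_add_iff 1).2 hs
  obtain ⟨K', hK'⟩ := lipschitzWith_symmQuot (a := a 0) hu
  -- The sequence starts at `m + 1`, since `u` itself need not be differentiable.
  refine hasDerivAt_of_tendstoUniformly (l := atTop) (f := fun m => iterAvg a u (m + 1))
    (tendstoUniformly_iterAvg (fun i => ha (i + 1)) hs' hK') ?_ ?_ x
  · refine Eventually.of_forall fun m y => ?_
    rw [iterAvg_succ']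
    exact hasDerivAt_iterAvg _ hK'.continuous (hasDerivAt_avg hu.continuous) m y
  · exact fun y => (tendsto_iterAvg ha hs hu y).comp (tendsto_add_atTop_nat 1)

theorem contDiff_smoothing (ha : ∀ i, 0 < a i) (hs : Summable a) (hu : LipschitzWith K u) :
    ContDiff ℝ ∞ (smoothing a u) := by
  rw [contDiff_infty]
  intro n
  induction n generalizing a u K with
  | zero =>
    exact contDiff_zero.2 (continuous_iff_continuousAt.2 fun x =>
      (hasDerivAt_smoothing ha hs hu x).continuousAt)
  | succ n ih =>
    obtain ⟨K', hK'⟩ := lipschitzWith_symmQuot (a := a 0) hu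
    have hd := hasDerivAt_smoothing ha hs hu
    push_cast
    rw [contDiff_succ_iff_deriv]
    refine ⟨fun x => (hd x).differentiableAt, by simp, ?_⟩
    rw [funext fun x => (hd x).deriv]
    exact ih (fun i => ha (i + 1)) ((summable_nat_add_iff 1).2 hs) hK'

theorem abs_smoothing_sub_le (ha : ∀ i, 0 < a i) (hs : Summable a) (hu : LipschitzWith K u)
    {c ε x : ℝ} (h : ∀ y, |y - x| ≤ ∑' i, a i → |u y - c| ≤ ε) :
    |smoothing a u x - c| ≤ ε := by
  refine le_of_tendsto ((tendsto_iterAvg ha hs hu x).sub_const c).abs (Eventually.of_forall ?_)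
  exact fun m => abs_iterAvg_sub_le ha hu.continuous m x fun y hy =>
    h y (hy.trans (hs.sum_le_tsum _ fun i _ => (ha i).le))

/-- The i-th differentiation replaces the function by a difference quotient of step `a i`, which
multiplies the sup bound by `1 / a i`. -/
theorem abs_iteratedDeriv_smoothing_le (ha : ∀ i, 0 < a i) (hs : Summable a)
    (hu : LipschitzWith K u) {c : ℝ} (hc : ∀ x, |u x| ≤ c) (k : ℕ) (x : ℝ) :
    |iteratedDeriv k (smoothing a u) x| ≤ c * ∏ i ∈ Finset.range k, 1 / a i := by
  induction k generalizing a u K c with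
  | zero =>
    have := abs_smoothing_sub_le ha hs hu (c := 0) (ε := c) (x := x) fun y _ => by simpa using hc y
    simpa using this
  | succ k ih =>
    obtain ⟨K', hK'⟩ := lipschitzWith_symmQuot (a := a 0) hu
    rw [iteratedDeriv_succ', funext fun x => (hasDerivAt_smoothing ha hs hu x).deriv,
      Finset.prod_range_succ', mul_comm (∏ i ∈ _, _), ← mul_assoc]
    exact ih (fun i => ha (i + 1)) ((summable_nat_add_iff 1).2 hs) hK' (abs_symmQuot_le (ha 0) hc)

end

/-! ### Cutoffs and truncated monomials -/

/-- A trapezoidal function: `1` on `[-2H, 2H]`, `0` off `[-3H, 3H]`. -/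
noncomputable def trapezoid (H x : ℝ) : ℝ := max 0 (min 1 (3 - |x| / H))

theorem lipschitzWith_trapezoid (H : ℝ) : ∃ K, LipschitzWith K (trapezoid H) := by
  have h : LipschitzWith (‖H⁻¹‖₊ * 1) fun x : ℝ => 3 - |x| / H := by
    refine LipschitzWith.of_dist_le_mul fun x y => ?_
    have : (3 - |x| / H) - (3 - |y| / H) = H⁻¹ * (|y| - |x|) := by ring
    rw [Real.dist_eq, Real.dist_eq, this, abs_mul]
    simp only [mul_one, coe_nnnorm, Real.norm_eq_abs]
    refine mul_le_mul_of_nonneg_left ?_ (abs_nonneg _)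
    rw [abs_sub_comm x y]
    exact abs_abs_sub_abs_le y x
  exact ⟨_, (h.const_min 1).const_max 0⟩

/-- Cutoff functions whose derivatives are controlled by a summable sequence of widths. -/
theorem exists_cutoff {a : ℕ → ℝ} (ha : ∀ i, 0 < a i) (hs : Summable a) :
    ∃ χ : ℝ → ℝ, ContDiff ℝ ∞ χ ∧ (∀ x, |x| ≤ ∑' i, a i → χ x = 1) ∧
      (∀ x, 4 * ∑' i, a i < |x| → χ x = 0) ∧
      ∀ k x, |iteratedDeriv k χ x| ≤ ∏ i ∈ Finset.range k, 1 / a i := by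
  set H := ∑' i, a i with hH
  have hHpos : 0 < H := hs.tsum_pos (fun i => (ha i).le) 0 (ha 0)
  obtain ⟨K, hK⟩ := lipschitzWith_trapezoid H
  refine ⟨smoothing a (trapezoid H), contDiff_smoothing ha hs hK, fun x hx => ?_, fun x hx => ?_,
    fun k x => ?_⟩
  -- The smoothing at `x` sees `u` only within distance `H`: a point of `[-H, H]` sees the plateau,
  -- and a point beyond `4H` sees only zeros.
  · refine sub_eq_zero.1 (abs_nonpos_iff.1 (abs_smoothing_sub_le ha hs hK fun y hy => ?_))
    have h1 : |y| ≤ 2 * H := by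
      have := abs_sub_abs_le_abs_sub y x
      linarith
    have h2 : |y| / H ≤ 2 := by rw [div_le_iff₀ hHpos]; exact h1
    rw [trapezoid, min_eq_left (by linarith), max_eq_right zero_le_one, sub_self, abs_zero]
  · refine (sub_eq_zero.1 (abs_nonpos_iff.1 (abs_smoothing_sub_le (c := 0) ha hs hK
      fun y hy => ?_)))
    have h1 : 3 * H ≤ |y| := by
      have := abs_sub_abs_le_abs_sub x y
      rw [abs_sub_comm] at this
      linarith
    have h2 : 3 ≤ |y| / H := by rw [le_div_iff₀ hHpos]; exact h1
    rw [trapezoid, max_eq_left ((min_le_right _ _).trans (by linarith)), sub_self, abs_zero]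
  · have := abs_iteratedDeriv_smoothing_le ha hs hK (c := 1) (fun x => ?_) k x
    · simpa using this
    · rw [trapezoid, abs_of_nonneg (le_max_left _ _)]
      exact max_le zero_le_one (min_le_left _ _)

theorem iteratedDeriv_pow_div_factorial_mul_zero {χ : ℝ → ℝ} (hχ : ∀ᶠ x in 𝓝 0, χ x = 1)
    (p j : ℕ) :
    iteratedDeriv j (fun x => x ^ p / (p ! : ℝ) * χ x) 0 = if j = p then 1 else 0 := by
  have h : (fun x => x ^ p / (p ! : ℝ) * χ x) =ᶠ[𝓝 0] fun x => x ^ p / (p ! : ℝ) := by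
    filter_upwards [hχ] with x hx
    rw [hx, mul_one]
  rw [h.iteratedDeriv_eq, iteratedDeriv_div_const, iteratedDeriv_fun_pow_zero]
  split_ifs
  · exact div_self (by positivity)
  · simp

/-- In each Leibniz term, `R^{p-j}/(p-j)!` is at most `exp(Rβ) β^{-(p-j)}`, and the missing `β^j` is
absorbed into `Θ` by `hmono`. The binomial coefficients sum to `2^k`. -/
theorem abs_iteratedDeriv_pow_div_factorial_mul_le {χ : ℝ → ℝ} (hχ : ContDiff ℝ ∞ χ)
    {R β : ℝ} (hβ : 0 < β) (hsupp : ∀ x, R < |x| → χ x = 0) {Θ : ℕ → ℝ}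
    (hΘ : ∀ k x, |iteratedDeriv k χ x| ≤ Θ k)
    (hmono : ∀ i j, β ^ i * Θ j ≤ Θ (i + j)) (p k : ℕ) (x : ℝ) :
    |iteratedDeriv k (fun x => x ^ p / (p ! : ℝ) * χ x) x|
      ≤ 2 ^ k * (Real.exp (R * β) * Θ k / β ^ p) := by
  have hΘ0 : 0 ≤ Θ k := (abs_nonneg _).trans (hΘ k x)
  by_cases hx : R < |x|
  · have h : (fun x => x ^ p / (p ! : ℝ) * χ x) =ᶠ[𝓝 x] fun _ => 0 := by
      filter_upwards [continuous_abs.continuousAt.eventually_const_lt hx] with y hy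
      rw [hsupp y hy, mul_zero]
    rw [h.iteratedDeriv_eq, iteratedDeriv_const]
    simp only [ite_self, abs_zero]
    positivity
  push Not at hx
  have hR : 0 ≤ R := (abs_nonneg _).trans hx
  have hpow : ContDiff ℝ ∞ fun x : ℝ => x ^ p / (p ! : ℝ) := by fun_prop
  rw [iteratedDeriv_fun_mul (hpow.contDiffAt.of_le (by exact_mod_cast le_top))
    (hχ.contDiffAt.of_le (by exact_mod_cast le_top))]
  refine (Finset.abs_sum_le_sum_abs _ _).trans ?_
  rw [← Nat.cast_ofNat (R := ℝ), ← Nat.cast_pow, ← Nat.sum_range_choose, Nat.cast_sum,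
    Finset.sum_mul]
  refine Finset.sum_le_sum fun j hj => ?_
  have hjk : j + (k - j) = k := by have := Finset.mem_range.1 hj; omega
  rw [mul_assoc, abs_mul, Nat.abs_cast, abs_mul]
  refine mul_le_mul_of_nonneg_left ?_ (Nat.cast_nonneg _)
  rw [iteratedDeriv_div_const, iteratedDeriv_pow]
  by_cases hjp : p < j
  · rw [Nat.descFactorial_of_lt hjp]
    simp only [Nat.cast_zero, zero_mul, zero_div, abs_zero]
    positivity
  push Not at hjp
  have h1 : |(p.descFactorial j : ℝ) * x ^ (p - j) / (p ! : ℝ)| ≤ R ^ (p - j) / ((p - j)! : ℝ) := by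
    rw [← Nat.factorial_mul_descFactorial hjp, abs_div, abs_mul, abs_pow, Nat.abs_cast,
      Nat.abs_cast, Nat.cast_mul]
    have : (0 : ℝ) < p.descFactorial j := by exact_mod_cast Nat.descFactorial_pos.2 hjp
    rw [mul_comm ((p - j)! : ℝ), mul_div_mul_left _ _ this.ne']
    gcongr
  have h2 : R ^ (p - j) / ((p - j)! : ℝ) * β ^ (p - j) ≤ Real.exp (R * β) := by
    have := Real.pow_div_factorial_le_exp (R * β) (by positivity) (p - j)
    rw [mul_pow] at this
    linarith [this, div_mul_eq_mul_div (R ^ (p - j)) ((p - j)! : ℝ) (β ^ (p - j))]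
  have h3 : β ^ j * Θ (k - j) ≤ Θ k := by simpa only [hjk] using hmono j (k - j)
  have h4 : β ^ (p - j) * β ^ j = β ^ p := by rw [← pow_add, Nat.sub_add_cancel hjp]
  rw [le_div_iff₀ (by positivity), ← h4]
  calc _ ≤ R ^ (p - j) / ((p - j)! : ℝ) * Θ (k - j) * (β ^ (p - j) * β ^ j) := by
        gcongr
        exact hΘ _ _
    _ = (R ^ (p - j) / ((p - j)! : ℝ) * β ^ (p - j)) * (β ^ j * Θ (k - j)) := by ring
    _ ≤ _ := by
        have : 0 ≤ Θ (k - j) := (abs_nonneg _).trans (hΘ (k - j) x)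
        gcongr

/-! ### Summation of dual functions -/

/-- A sequence with growth controlled by `W` is the sequence of derivatives at `0` of a smooth
function, provided that there are functions `ψ p` dual to the derivatives with suitable bounds. -/
theorem exists_iteratedDeriv_eq_of_dual {ψ : ℕ → ℝ → ℝ} (hψ : ∀ p, ContDiff ℝ ∞ (ψ p))
    (hψ0 : ∀ p j, iteratedDeriv j (ψ p) 0 = if j = p then 1 else 0)
    {A D τ C : ℝ} {W N : ℕ → ℝ} (hD : 0 ≤ D) (hN : ∀ k, 0 ≤ N k) (hC : 0 ≤ C)
    (hA : 0 ≤ A) (hbd : ∀ p k x, |iteratedDeriv k (ψ p) x| * W p ≤ A * D ^ p * C ^ k * N k)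
    {a : ℕ → ℂ} {A' : ℝ} (hA' : 0 ≤ A') (hτ : 0 ≤ τ) (ha : ∀ p, ‖a p‖ ≤ A' * τ ^ p * W p) :
    ∃ f : ℝ → ℂ, ContDiff ℝ ∞ f ∧ (∀ k, iteratedDeriv k f 0 = a k) ∧
      ∃ B σ : ℝ, 0 ≤ B ∧ 0 ≤ σ ∧ ∀ k x, ‖iteratedDeriv k f x‖ ≤ B * σ ^ k * N k := by
  -- Chosen so that `Dτ / t ≤ 1/2`; the `1` keeps `t` positive.
  set t : ℝ := 2 * (D * τ) + 1 with ht
  have htpos : 0 < t := by positivity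
  set g : ℕ → ℝ → ℂ := fun p x => ψ p (t * x) • (((t ^ p)⁻¹ : ℝ) • a p) with hg
  have hψt (p : ℕ) : ContDiff ℝ ∞ fun x => ψ p (t * x) := (hψ p).comp (by fun_prop)
  have hgs (p : ℕ) : ContDiff ℝ ∞ (g p) := (hψt p).smul contDiff_const
  have hgd (p k : ℕ) (x : ℝ) :
      iteratedDeriv k (g p) x = (t ^ k * iteratedDeriv k (ψ p) (t * x)) • ((t ^ p)⁻¹ : ℝ) • a p := by
    rw [hg, iteratedDeriv_smul_const ((hψt p).contDiffAt.of_le (by exact_mod_cast le_top)),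
      iteratedDeriv_comp_const_mul ((hψ p).of_le (by exact_mod_cast le_top))]
  set v : ℕ → ℕ → ℝ := fun k p => A * A' * (t * C) ^ k * N k * (1 / 2) ^ p with hv
  have hbound (k p : ℕ) (x : ℝ) : ‖iteratedDeriv k (g p) x‖ ≤ v k p := by
    rw [hgd, norm_smul, norm_smul, Real.norm_eq_abs, Real.norm_eq_abs, abs_mul,
      abs_of_pos (by positivity : 0 < t ^ k), abs_of_pos (by positivity : 0 < (t ^ p)⁻¹)]
    have h1 : (D * τ) ^ p * (t ^ p)⁻¹ ≤ (1 / 2) ^ p := by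
      rw [← inv_pow, ← mul_pow]
      refine pow_le_pow_left₀ (by positivity) ?_ p
      rw [← div_eq_mul_inv, div_le_iff₀ htpos]
      linarith
    calc t ^ k * |iteratedDeriv k (ψ p) (t * x)| * ((t ^ p)⁻¹ * ‖a p‖)
        ≤ t ^ k * |iteratedDeriv k (ψ p) (t * x)| * ((t ^ p)⁻¹ * (A' * τ ^ p * W p)) := by
          gcongr
          exact ha p
      _ = t ^ k * (t ^ p)⁻¹ * A' * τ ^ p * (|iteratedDeriv k (ψ p) (t * x)| * W p) := by ring
      _ ≤ t ^ k * (t ^ p)⁻¹ * A' * τ ^ p * (A * D ^ p * C ^ k * N k) :=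
          mul_le_mul_of_nonneg_left (hbd _ _ _) (by positivity)
      _ = A * A' * (t * C) ^ k * N k * ((D * τ) ^ p * (t ^ p)⁻¹) := by
          rw [mul_pow, mul_pow]; ring
      _ ≤ _ := by
          have := hN k
          simp only [hv]
          gcongr
  have hvs (k : ℕ) : Summable (v k) := summable_geometric_two.mul_left _
  have hbound' (k p : ℕ) (x : ℝ) : ‖iteratedFDeriv ℝ k (g p) x‖ ≤ v k p := by
    rw [norm_iteratedFDeriv_eq_norm_iteratedDeriv]
    exact hbound k p x
  have hgsum : ContDiff ℝ ∞ fun x => ∑' p, g p x :=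
    contDiff_tsum (N := ⊤) hgs (fun k _ => hvs k) fun k p x _ => hbound' k p x
  have hfd (k : ℕ) (x : ℝ) :
      iteratedDeriv k (fun x => ∑' p, g p x) x = ∑' p, iteratedDeriv k (g p) x := by
    simp only [iteratedDeriv_eq_iteratedFDeriv]
    rw [iteratedFDeriv_tsum_apply (N := ⊤) hgs (fun k _ => hvs k) (fun k p x _ => hbound' k p x)
      le_top]
    have hsum : Summable fun p => iteratedFDeriv ℝ k (g p) x :=
      (hvs k).of_norm_bounded fun p => hbound' k p x
    exact ContinuousMultilinearMap.tsum_eval hsum _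
  refine ⟨fun x => ∑' p, g p x, hgsum, fun k => ?_, 2 * (A * A'), t * C, by positivity,
    by positivity, fun k x => ?_⟩
  · rw [hfd, tsum_eq_single k]
    · rw [hgd, mul_zero, hψ0, if_pos rfl, mul_one, smul_smul, mul_inv_cancel₀ (by positivity),
        one_smul]
    · intro p hp
      rw [hgd, mul_zero, hψ0, if_neg hp.symm, mul_zero, zero_smul]
  · rw [hfd]
    refine (tsum_of_norm_bounded (hvs k).hasSum fun p => hbound k p x).trans (le_of_eq ?_)
    simp only [hv]
    rw [tsum_mul_left, tsum_geometric_two]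
    ring

/-! ### Weight sequences and the slopes supplied by `≺_SV` -/

section

variable {M : ℕ → ℝ}

theorem IsWeightSequence.apply_zero (hM : IsWeightSequence M) : M 0 = 1 := hM.quot_zero

theorem IsWeightSequence.apply_succ (hM : IsWeightSequence M) (k : ℕ) :
    M (k + 1) = quot M (k + 1) * M k := by
  rw [quot, div_mul_cancel₀ _ (hM.pos k).ne']

theorem IsWeightSequence.one_le_quot (hM : IsWeightSequence M) (k : ℕ) : 1 ≤ quot M k :=
  hM.quot_zero ▸ hM.quot_mono (Nat.zero_le k)

theorem IsWeightSequence.quot_pos (hM : IsWeightSequence M) (k : ℕ) : 0 < quot M k :=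
  zero_lt_one.trans_le (hM.one_le_quot k)

theorem IsWeightSequence.pow_mul_le (hM : IsWeightSequence M) {c : ℝ} (hc : 0 ≤ c) (m n : ℕ)
    (h : c ≤ quot M (m + 1)) : c ^ n * M m ≤ M (m + n) := by
  induction n with
  | zero => simp
  | succ n ih =>
    rw [← add_assoc, hM.apply_succ, pow_succ', mul_assoc]
    have h1 : c ≤ quot M (m + n + 1) := h.trans (hM.quot_mono (by omega))
    have := hM.pos m
    have := hM.quot_pos (m + n + 1)
    gcongr

theorem IsWeightSequence.le_pow_mul (hM : IsWeightSequence M) (m n : ℕ) :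
    M (m + n) ≤ quot M (m + n) ^ n * M m := by
  induction n with
  | zero => simp
  | succ n ih =>
    have h1 : quot M (m + n) ≤ quot M (m + n + 1) := hM.quot_mono (by omega)
    have := hM.pos m
    have := hM.quot_pos (m + n + 1)
    have := hM.quot_pos (m + n)
    rw [← add_assoc, hM.apply_succ, pow_succ', mul_assoc]
    gcongr
    exact ih.trans (by gcongr)

theorem IsNonQuasianalytic.summable_add (hM : IsNonQuasianalytic M) {j : ℕ} (hj : 1 ≤ j) :
    Summable fun k => 1 / quot M (j + k) := by
  have := (summable_nat_add_iff (f := fun k => 1 / quot M (k + 1)) (j - 1)).2 hM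
  refine this.congr fun k => ?_
  rw [show k + (j - 1) + 1 = j + k by omega]

/-- Reformulation of `≺_SV` by a choice of slopes `β` not exceeding the quotients of `M`. -/
theorem PrecSV.exists_slope {M' : ℕ → ℝ} (h : PrecSV M' M) (hM' : IsPositive M')
    (hM : IsWeightSequence M) (hnq : IsNonQuasianalytic M) :
    ∃ s B : ℝ, 1 ≤ s ∧ 0 ≤ B ∧ ∀ N : ℕ, 1 ≤ N → ∃ β : ℝ, 0 < β ∧ β ≤ quot M N ∧
      β * ∑' k, 1 / quot M (N + k) ≤ B * N ∧ ∀ i ≤ N, M' N ≤ s ^ N * (β ^ (N - i) * M i) := by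
  obtain ⟨s, hs, B, hB⟩ := h
  have hs' : (1 : ℝ) ≤ s := by exact_mod_cast hs
  set B₁ := max B 1 with hB₁
  have hB₁1 : 1 ≤ B₁ := le_max_right _ _
  have hss : (s : ℝ) ≤ 2 * B₁ * s := by nlinarith
  refine ⟨2 * B₁ * s, B₁, hs'.trans hss, by linarith, fun N hN => ?_⟩
  have hN0 : (0 : ℝ) < N := by exact_mod_cast hN
  set F : Fin N → ℝ :=
    fun i => (M' N / ((s : ℝ) ^ N * M i)) ^ (1 / ((N : ℝ) - ((i : ℕ) : ℝ))) with hF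
  set l := ⨆ i, F i with hl
  have hle (i : Fin N) : F i ≤ l := le_ciSup (Set.finite_range F).bddAbove i
  have hFpos (i : Fin N) : 0 < F i := by
    have := hM' N
    have := hM.pos i
    positivity
  have hlpos : 0 < l := (hFpos ⟨0, hN⟩).trans_le (hle _)
  set S := ∑' k, 1 / quot M (N + k) with hS
  have hS1 : 1 / quot M N ≤ S := by
    have := (hnq.summable_add hN).le_tsum 0 fun k _ => (one_div_pos.2 (hM.quot_pos _)).le
    simpa only [add_zero] using this
  have hS0 : 0 < S := (one_div_pos.2 (hM.quot_pos _)).trans_le hS1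
  have hlS : l * S ≤ B₁ * N := by
    have := (hB N hN).trans (le_max_left B 1)
    rwa [div_mul_eq_mul_div, div_le_iff₀ hN0] at this
  have hterm (i : ℕ) (hi : i < N) : M' N ≤ (s : ℝ) ^ N * (l ^ (N - i) * M i) := by
    have hMi := hM.pos i
    have h0 : 0 ≤ M' N / ((s : ℝ) ^ N * M i) := by
      have := hM' N
      positivity
    have h1 : M' N / ((s : ℝ) ^ N * M i) ≤ l ^ (N - i) := by
      have h2 := pow_le_pow_left₀ (hFpos ⟨i, hi⟩).le (hle ⟨i, hi⟩) (N - i)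
      simp only [hF] at h2
      rwa [one_div, ← Nat.cast_sub hi.le, Real.rpow_inv_natCast_pow h0 (by omega)] at h2
    rw [div_le_iff₀ (by positivity)] at h1
    linarith
  -- The supremum omits `i = N`. This case follows from `i = N - 1` together with `l ≤ B₁ N μ_N` and
  -- `N ≤ 2^N`, whence the factor `2 * B₁` in the new `s`.
  have hNN : M' N ≤ (2 * B₁ * s) ^ N * M N := by
    obtain ⟨m, rfl⟩ : ∃ m, N = m + 1 := ⟨N - 1, by omega⟩
    have hq := hM.quot_pos (m + 1)
    have hMm := hM.pos m
    have h1 : l ≤ B₁ ^ (m + 1) * 2 ^ (m + 1) * quot M (m + 1) := by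
      have h2 : l * (1 / quot M (m + 1)) ≤ B₁ * ↑(m + 1) :=
        (mul_le_mul_of_nonneg_left hS1 hlpos.le).trans hlS
      rw [mul_one_div, div_le_iff₀ hq] at h2
      refine h2.trans ?_
      have h3 : ((m + 1 : ℕ) : ℝ) ≤ 2 ^ (m + 1) := by exact_mod_cast Nat.lt_two_pow_self.le
      have h4 : B₁ ≤ B₁ ^ (m + 1) := le_self_pow₀ hB₁1 (by omega)
      gcongr
    have h5 := hterm m (by omega)
    rw [Nat.add_sub_cancel_left, pow_one] at h5
    rw [hM.apply_succ]
    calc M' (m + 1) ≤ (s : ℝ) ^ (m + 1) * (l * M m) := h5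
      _ ≤ (s : ℝ) ^ (m + 1) * (B₁ ^ (m + 1) * 2 ^ (m + 1) * quot M (m + 1) * M m) := by gcongr
      _ = _ := by rw [mul_pow, mul_pow]; ring
  -- Truncation at `μ_N` gives `β ≤ μ_N`. Where it is active, `M_N ≤ μ_N^{N-i} M_i` reduces every
  -- `i` to `hNN`.
  refine ⟨min l (quot M N), lt_min hlpos (hM.quot_pos N), min_le_right _ _,
    (mul_le_mul_of_nonneg_right (min_le_left _ _) hS0.le).trans hlS, fun i hi => ?_⟩
  have hMi := hM.pos i
  rcases min_choice l (quot M N) with h | h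
  · rw [h]
    rcases hi.lt_or_eq with hi | rfl
    · refine (hterm i hi).trans ?_
      gcongr
    · simpa using hNN
  · rw [h]
    refine hNN.trans ?_
    have h1 := hM.le_pow_mul i (N - i)
    rw [Nat.add_sub_cancel' hi] at h1
    gcongr

end

/-- Moderate growth splits off one summand `k` at a time; the order of the matrix merges the two
resulting sequences into one. -/
theorem IsWeightMatrix.exists_apply_mul_le {M : Ioi (0 : ℝ) → ℕ → ℝ} (hM : IsWeightMatrix M)
    (hmg : HasRModerateGrowth M) (n : ℕ) (x : Ioi (0 : ℝ)) :
    ∃ y, ∃ C : ℝ, 1 ≤ C ∧ ∀ k, M x (n * k) ≤ C ^ k * M y k ^ n := by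
  induction n generalizing x with
  | zero =>
    refine ⟨x, 1, le_rfl, fun k => ?_⟩
    rw [Nat.zero_mul, (hM.isWeightSequence x).apply_zero]
    simp
  | succ n ih =>
    obtain ⟨y, C₁, hC₁, h₁⟩ := hmg x
    obtain ⟨z, C₂, hC₂, h₂⟩ := ih y
    refine ⟨max y z, C₁ ^ (n + 1) * C₂,
      one_le_mul_of_one_le_of_one_le (one_le_pow₀ hC₁) hC₂, fun k => ?_⟩
    have hy := (hM.isWeightSequence y).pos k
    have hz := (hM.isWeightSequence z).pos k
    have hw := (hM.isWeightSequence (max y z)).pos k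
    have hyw := hM.mono y _ (le_max_left y z) k
    have hzw := hM.mono z _ (le_max_right y z) k
    calc M x ((n + 1) * k) = M x (n * k + k) := by rw [Nat.succ_mul]
      _ ≤ C₁ ^ (n * k + k) * M y (n * k) * M y k := h₁ _ _
      _ ≤ C₁ ^ (n * k + k) * (C₂ ^ k * M (max y z) k ^ n) * M (max y z) k := by
          gcongr
          exact (h₂ k).trans (by gcongr)
      _ = _ := by
          rw [mul_pow, ← pow_mul, Nat.succ_mul]; ring

/-! ### Flattened quotients and dual functions -/

section

variable {M : ℕ → ℝ}

/-- The quotients of `M` with the first `N` ones replaced by `β`. -/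
noncomputable def flatQuot (M : ℕ → ℝ) (N : ℕ) (β : ℝ) (i : ℕ) : ℝ :=
  if i < N then β else quot M (i + 1)

theorem le_flatQuot (hM : IsWeightSequence M) {N : ℕ} {β : ℝ} (hβM : β ≤ quot M N) (i : ℕ) :
    β ≤ flatQuot M N β i := by
  unfold flatQuot
  split_ifs with h
  · exact le_rfl
  · exact hβM.trans (hM.quot_mono (by omega))

theorem hasSum_one_div_flatQuot (hnq : IsNonQuasianalytic M) (N : ℕ) (β : ℝ) :
    HasSum (fun i => 1 / flatQuot M N β i) (N / β + ∑' k, 1 / quot M (N + 1 + k)) := by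
  have h := (hnq.summable_add (j := N + 1) (by omega)).hasSum
  rw [← hasSum_nat_add_iff' N]
  have h1 : ∑ i ∈ Finset.range N, 1 / flatQuot M N β i = N / β := by
    rw [Finset.sum_congr rfl fun i hi => by rw [flatQuot, if_pos (Finset.mem_range.1 hi)]]
    simp [div_eq_mul_inv]
  rw [h1, add_sub_cancel_left]
  refine h.congr_fun fun k => ?_
  rw [flatQuot, if_neg (by omega), show k + N + 1 = N + 1 + k by omega]

/-- With half-widths `1/θ_i` of sum `H`, the bound on the tail gives `Hβ ≤ N + BN`. The cutoff
vanishes beyond `4H`, hence the exponent. -/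
theorem exists_dual_function (hM : IsWeightSequence M) (hnq : IsNonQuasianalytic M)
    {N : ℕ} (hN : 1 ≤ N) {β B : ℝ} (hβ : 0 < β) (hβM : β ≤ quot M N)
    (hB : β * ∑' k, 1 / quot M (N + k) ≤ B * N) (p : ℕ) :
    ∃ ψ : ℝ → ℝ, ContDiff ℝ ∞ ψ ∧ (∀ j, iteratedDeriv j ψ 0 = if j = p then 1 else 0) ∧
      ∀ k x, |iteratedDeriv k ψ x| ≤ 2 ^ k *
        (Real.exp (4 * (B + 1) * N) * (∏ i ∈ Finset.range k, flatQuot M N β i) / β ^ p) := by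
  have hθ := le_flatQuot hM hβM
  have hθ0 (i : ℕ) : 0 < flatQuot M N β i := hβ.trans_le (hθ i)
  have hsum := hasSum_one_div_flatQuot hnq N β
  obtain ⟨χ, hχ, hχ1, hχ0, hχd⟩ := exists_cutoff (fun i => one_div_pos.2 (hθ0 i)) hsum.summable
  simp only [one_div_one_div] at hχd
  set H := ∑' i, 1 / flatQuot M N β i with hH
  have hHpos : 0 < H := hsum.summable.tsum_pos (fun i => (one_div_pos.2 (hθ0 i)).le) 0
    (one_div_pos.2 (hθ0 0))
  have hHβ : 4 * H * β ≤ 4 * (B + 1) * N := by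
    -- Entry `i` of `flatQuot` stands for `μ_{i+1}`, so its unflattened tail starts at `N + 1`,
    -- while `hB` starts at `N`.
    have h1 : ∑' k, 1 / quot M (N + 1 + k) ≤ ∑' k, 1 / quot M (N + k) := by
      rw [(hnq.summable_add hN).tsum_eq_zero_add]
      simp only [add_zero, ← add_assoc, add_right_comm N _ 1]
      have := (one_div_pos.2 (hM.quot_pos N)).le
      linarith
    rw [hH, hsum.tsum_eq]
    have h2 : N / β * β = N := div_mul_cancel₀ _ hβ.ne'
    nlinarith
  refine ⟨fun x => x ^ p / (p ! : ℝ) * χ x, ContDiff.mul (by fun_prop) hχ,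
    iteratedDeriv_pow_div_factorial_mul_zero ?_ p, fun k x => ?_⟩
  · filter_upwards [Metric.ball_mem_nhds (0 : ℝ) hHpos] with x hx
    exact hχ1 x (by simpa using (Metric.mem_ball.1 hx).le)
  · refine (abs_iteratedDeriv_pow_div_factorial_mul_le hχ hβ hχ0 hχd (fun i j => ?_) p k x).trans ?_
    · induction i with
      | zero => simp
      | succ i ih =>
        rw [Nat.succ_add, Finset.prod_range_succ, pow_succ, mul_right_comm]
        have : 0 ≤ ∏ l ∈ Finset.range (i + j), flatQuot M N β l :=
          Finset.prod_nonneg fun l _ => (hθ0 l).le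
        exact mul_le_mul ih (hθ _) hβ.le this
    · have : 0 ≤ ∏ l ∈ Finset.range k, flatQuot M N β l :=
        Finset.prod_nonneg fun l _ => (hθ0 l).le
      gcongr

/-- For `k ≤ p` the product is `β^k` and the hypothesis at `i = nk` is exactly what is needed.
Beyond `p`, each step multiplies the left side by `θ_k^n`, while `M_{nk}` gains `n` quotients, each
at least `θ_k`. -/
theorem prod_flatQuot_pow_mul_le (hM : IsWeightSequence M) {n p : ℕ} (hn : 1 ≤ n)
    {β s Q : ℝ} (hβ : 0 < β) (hβM : β ≤ quot M (n * p)) (hQ : 0 ≤ Q)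
    (h : ∀ i ≤ n * p, Q ≤ s ^ (n * p) * (β ^ (n * p - i) * M i)) (k : ℕ) :
    (∏ i ∈ Finset.range k, flatQuot M (n * p) β i) ^ n * Q
      ≤ s ^ (n * p) * β ^ (n * p) * M (n * k) := by
  rcases le_total k p with hk | hk
  · have hnk : n * k ≤ n * p := Nat.mul_le_mul_left n hk
    have h1 : ∏ i ∈ Finset.range k, flatQuot M (n * p) β i = β ^ k := by
      rw [Finset.prod_congr rfl fun i hi => by
        rw [flatQuot, if_pos ((Finset.mem_range.1 hi).trans_le
          (hk.trans (Nat.le_mul_of_pos_left p hn)))]]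
      simp
    rw [h1, ← pow_mul, mul_comm k n]
    calc β ^ (n * k) * Q ≤ β ^ (n * k) * (s ^ (n * p) * (β ^ (n * p - n * k) * M (n * k))) := by
          gcongr
          exact h _ hnk
      _ = s ^ (n * p) * (β ^ (n * k) * β ^ (n * p - n * k)) * M (n * k) := by ring
      _ = _ := by rw [← pow_add, Nat.add_sub_cancel' hnk]
  · induction k, hk using Nat.le_induction with
    | base =>
      have h1 : ∏ i ∈ Finset.range p, flatQuot M (n * p) β i = β ^ p := by
        rw [Finset.prod_congr rfl fun i hi => by
          rw [flatQuot, if_pos ((Finset.mem_range.1 hi).trans_le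
            (Nat.le_mul_of_pos_left p hn))]]
        simp
      rw [h1, ← pow_mul, mul_comm p n]
      have := h _ le_rfl
      rw [Nat.sub_self, pow_zero, one_mul] at this
      calc β ^ (n * p) * Q ≤ β ^ (n * p) * (s ^ (n * p) * M (n * p)) := by gcongr
        _ = _ := by ring
    | succ k hk ih =>
      have hnk : n * p ≤ n * k := Nat.mul_le_mul_left n hk
      have hkn : k ≤ n * k := Nat.le_mul_of_pos_left k hn
      have hθ0 : 0 ≤ flatQuot M (n * p) β k := hβ.le.trans (le_flatQuot hM hβM k)
      have hθ : flatQuot M (n * p) β k ≤ quot M (n * k + 1) := by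
        unfold flatQuot
        split_ifs
        · exact hβM.trans (hM.quot_mono (by omega))
        · exact hM.quot_mono (by omega)
      have h1 := hM.pow_mul_le hθ0 (n * k) n hθ
      -- The sign of `s` is not assumed; the case `i = 0` of `h` yields this since `M_0 = 1`.
      have hs : 0 ≤ s ^ (n * p) * β ^ (n * p) := by
        have h2 := hQ.trans (h 0 (Nat.zero_le _))
        rwa [Nat.sub_zero, hM.apply_zero, mul_one] at h2
      rw [Finset.prod_range_succ, mul_pow, Nat.mul_succ]
      calc _ = flatQuot M (n * p) β k ^ n
            * ((∏ i ∈ Finset.range k, flatQuot M (n * p) β i) ^ n * Q) := by ring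
        _ ≤ flatQuot M (n * p) β k ^ n * (s ^ (n * p) * β ^ (n * p) * M (n * k)) := by gcongr
        _ = s ^ (n * p) * β ^ (n * p) * (flatQuot M (n * p) β k ^ n * M (n * k)) := by ring
        _ ≤ _ := by gcongr

end

theorem PrecSV.exists_dual_family {M M' N : ℕ → ℝ} (h : PrecSV M' M) (hM' : IsPositive M')
    (hM : IsWeightSequence M) (hnq : IsNonQuasianalytic M) (hN : IsWeightSequence N)
    {n : ℕ} (hn : 1 ≤ n) {C : ℝ} (hC : 1 ≤ C) (hMN : ∀ k, M (n * k) ≤ C ^ k * N k ^ n) :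
    ∃ ψ : ℕ → ℝ → ℝ, (∀ p, ContDiff ℝ ∞ (ψ p)) ∧
      (∀ p j, iteratedDeriv j (ψ p) 0 = if j = p then 1 else 0) ∧
      ∃ A D : ℝ, 0 ≤ A ∧ 0 ≤ D ∧
        ∀ p k x, |iteratedDeriv k (ψ p) x| * bracket M' n p ≤ A * D ^ p * (2 * C) ^ k * N k := by
  obtain ⟨s, B, hs, hB, hβ⟩ := h.exists_slope hM' hM hnq
  set W := bracket M' n with hW
  have hWpos (p : ℕ) : 0 < W p := Real.rpow_pos_of_pos (hM' _) _
  have hWpow (p : ℕ) : W p ^ n = M' (n * p) := by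
    rw [hW, bracket, one_div, Real.rpow_inv_natCast_pow (hM' _).le (by omega)]
  set D := Real.exp (4 * (B + 1) * n) * s with hD
  have key (p : ℕ) : ∃ ψ : ℝ → ℝ, ContDiff ℝ ∞ ψ ∧
      (∀ j, iteratedDeriv j ψ 0 = if j = p then 1 else 0) ∧
      ∀ k x, |iteratedDeriv k ψ x| * W p ≤ (1 + W 0) * D ^ p * (2 * C) ^ k * N k := by
    rcases Nat.eq_zero_or_pos p with rfl | hp
    -- Slopes exist only for indices at least 1, so `p = 0` uses the constant function; the factor
    -- `1 + W 0` covers it.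
    · refine ⟨fun _ => 1, contDiff_const, fun j => by rw [iteratedDeriv_const], fun k x => ?_⟩
      rw [iteratedDeriv_const]
      have hNk := hN.pos k
      have hW0 := hWpos 0
      split_ifs with hk
      · subst hk
        rw [hN.apply_zero]
        simp
      · rw [abs_zero, zero_mul]
        positivity
    · have hnp : 1 ≤ n * p := Nat.mul_pos hn hp
      obtain ⟨β, hβ0, hβM, hβB, hβi⟩ := hβ (n * p) hnp
      obtain ⟨ψ, hψ, hψ0, hψd⟩ := exists_dual_function hM hnq hnp hβ0 hβM hβB p
      refine ⟨ψ, hψ, hψ0, fun k x => ?_⟩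
      set T := ∏ i ∈ Finset.range k, flatQuot M (n * p) β i with hT
      have hT0 : 0 ≤ T := Finset.prod_nonneg fun i _ => hβ0.le.trans (le_flatQuot hM hβM i)
      have hNk := hN.pos k
      have hWp := hWpos p
      have hW0 := hWpos 0
      have h1 : T / β ^ p * W p ≤ s ^ p * C ^ k * N k := by
        rw [← pow_le_pow_iff_left₀ (by positivity) (by positivity) (by omega : n ≠ 0)]
        have h2 := prod_flatQuot_pow_mul_le hM hn hβ0 hβM (hM' (n * p)).le hβi k
        rw [← hT] at h2
        rw [mul_pow, div_pow, hWpow, div_mul_eq_mul_div, div_le_iff₀ (by positivity)]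
        refine h2.trans ?_
        have h3 : C ^ k ≤ (C ^ k) ^ n := le_self_pow₀ (one_le_pow₀ hC) (by omega)
        calc s ^ (n * p) * β ^ (n * p) * M (n * k)
            ≤ s ^ (n * p) * β ^ (n * p) * ((C ^ k) ^ n * N k ^ n) := by
              gcongr
              exact (hMN k).trans (by gcongr)
          _ = _ := by rw [mul_pow, mul_pow, ← pow_mul s, ← pow_mul β, mul_comm p n]; ring
      -- The index `np` is linear in `p`, so the exponential loss is a p-th power and goes into `D`.
      have hE : Real.exp (4 * (B + 1) * ((n * p : ℕ) : ℝ)) = Real.exp (4 * (B + 1) * n) ^ p := by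
        rw [← Real.exp_nat_mul]
        push_cast
        ring_nf
      calc |iteratedDeriv k ψ x| * W p
          ≤ 2 ^ k * (Real.exp (4 * (B + 1) * ((n * p : ℕ) : ℝ)) * T / β ^ p) * W p := by
            gcongr
            exact hψd k x
        _ = 2 ^ k * Real.exp (4 * (B + 1) * n) ^ p * (T / β ^ p * W p) := by rw [hE]; ring
        _ ≤ 2 ^ k * Real.exp (4 * (B + 1) * n) ^ p * (s ^ p * C ^ k * N k) := by gcongr
        _ = 1 * (D ^ p * (2 * C) ^ k * N k) := by rw [hD, mul_pow, mul_pow]; ring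
        _ ≤ (1 + W 0) * (D ^ p * (2 * C) ^ k * N k) := by
            gcongr
            linarith
        _ = _ := by ring
  choose ψ hψ hψ0 hψd using key
  have := hWpos 0
  exact ⟨ψ, hψ, hψ0, 1 + W 0, D, by positivity, by positivity, hψd⟩

/-! ### Reduction to one sequence and conclusion -/

/-- Growth bounds pass along `⪯` at the cost of a geometric factor. -/
theorem exists_norm_le_of_preceq {M W : ℕ → ℝ} (hM : IsPositive M) (hW : IsPositive W)
    (h : Preceq M W) {a : ℕ → ℂ} {σ : ℝ} (hσ : 0 < σ) (ha : a ∈ sequenceSpace M σ) :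
    ∃ A τ : ℝ, 0 ≤ A ∧ 0 ≤ τ ∧ ∀ p, ‖a p‖ ≤ A * τ ^ p * W p := by
  obtain ⟨C, hC⟩ := ha
  obtain ⟨E, hE⟩ := h
  have hC0 : 0 ≤ C := by
    have := hM 0
    exact le_trans (by positivity) (hC 0)
  have hE0 : 0 ≤ E := by
    have := hM 1
    have := hW 1
    exact le_trans (by positivity) (hE 1 le_rfl)
  have h0 : 0 < M 0 / W 0 := div_pos (hM 0) (hW 0)
  -- `⪯` says nothing at `k = 0`; the summand `M 0 / W 0` covers that index.
  have hME (k : ℕ) : M k ≤ (1 + M 0 / W 0) * E ^ k * W k := by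
    rcases Nat.eq_zero_or_pos k with rfl | hk
    · have : M 0 / W 0 * W 0 = M 0 := div_mul_cancel₀ _ (hW 0).ne'
      have := hW 0
      linarith
    · have hr : 0 ≤ M k / W k := (div_pos (hM k) (hW k)).le
      have h1 := pow_le_pow_left₀ (by positivity) (hE k hk) k
      rw [one_div, Real.rpow_inv_natCast_pow hr (by omega), div_le_iff₀ (hW k)] at h1
      have h2 : 0 ≤ E ^ k * W k := by
        have := hW k
        positivity
      nlinarith
  refine ⟨C * (1 + M 0 / W 0), σ * E, by positivity, by positivity, fun p => ?_⟩
  have h1 := hC p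
  have hMp := hM p
  rw [div_le_iff₀ (by positivity)] at h1
  calc ‖a p‖ ≤ C * (σ ^ p * M p) := h1
    _ ≤ C * (σ ^ p * ((1 + M 0 / W 0) * E ^ p * W p)) := by
        gcongr
        exact hME p
    _ = _ := by rw [mul_pow]; ring

end MixedBorel

theorem mainTheorem11
    (M : Ioi (0 : ℝ) → ℕ → ℝ)
    (hM : MixedBorel.IsWeightMatrix M)
    (hMnq : ∀ x, MixedBorel.IsNonQuasianalytic (M x))
    (hMmg : MixedBorel.HasRModerateGrowth M)
    {ι : Type*} (M' : ι → ℕ → ℝ)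
    (hM'pos : ∀ i, MixedBorel.IsPositive (M' i))
    (hM'liminf : ∀ i, MixedBorel.LiminfPos (M' i))
    (i₀ : ι)
    (hred : ∀ i, ∃ n : ℕ, 1 ≤ n ∧
      MixedBorel.Preceq (M' i) (MixedBorel.bracket (M' i₀) n))
    (hSV : ∃ x₀, MixedBorel.PrecSV (M' i₀) (M x₀)) :
    MixedBorel.sequenceClass M' ⊆ MixedBorel.borelMap '' MixedBorel.functionClass M := by
  intro a ha
  simp only [MixedBorel.sequenceClass, mem_iUnion, mem_ofPred_eq] at ha
  obtain ⟨i, σ, hσ, ha⟩ := ha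
  obtain ⟨n, hn, hpre⟩ := hred i
  obtain ⟨x₀, hx₀⟩ := hSV
  obtain ⟨y, C, hC, hMy⟩ := hM.exists_apply_mul_le hMmg n x₀
  have hy := hM.isWeightSequence y
  obtain ⟨ψ, hψ, hψ0, A, D, hA, hD, hψd⟩ := hx₀.exists_dual_family (hM'pos i₀)
    (hM.isWeightSequence x₀) (hMnq x₀) hy hn hC hMy
  obtain ⟨A', τ, hA', hτ, haW⟩ := MixedBorel.exists_norm_le_of_preceq (hM'pos i)
    (fun p => Real.rpow_pos_of_pos (hM'pos i₀ _) _) hpre (by exact_mod_cast hσ) ha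
  obtain ⟨f, hf, hf0, B, ρ, hB, hρ, hfd⟩ := MixedBorel.exists_iteratedDeriv_eq_of_dual hψ hψ0 hD
    (fun k => (hy.pos k).le) (by positivity) hA hψd hA' hτ haW
  refine ⟨f, ?_, funext hf0⟩
  simp only [MixedBorel.functionClass, mem_iInter, mem_iUnion, mem_ofPred_eq]
  -- The bounds hold on all of ℝ, so one sequence and one integer `σ ≥ 1` above `ρ` serve every
  -- interval.
  refine fun m => ⟨y, ⌈ρ⌉₊ + 1, Nat.le_add_left 1 _, hf, B, fun x _ k => ?_⟩
  have hyk := hy.pos k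
  have hρle : ρ ≤ ((⌈ρ⌉₊ + 1 : ℕ) : ℝ) := by
    push_cast
    linarith [Nat.le_ceil ρ]
  have hpos : (0 : ℝ) < ((⌈ρ⌉₊ + 1 : ℕ) : ℝ) := by positivity
  rw [div_le_iff₀ (by positivity), ← mul_assoc]
  exact (hfd k x).trans (by gcongr)
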